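/- Let $K$ be a commutative ring with $1\neq 0$, let $\lambda\in K$, and let $X$ be a well-ordered set. Algebras are commutative and associative, but need not have a unit. Words. Let $Q(X)$ be the commutative semigroup (without empty word) of all words built from the elements of $X$ by the commutative associative product and a unary operator symbol $P$. Every $u\in Q(X)$ is a product of elements of $X\cup P(Q(X))$, unique up to order; the number of factors is its breadth $\mathrm{bre}(u)$. The depth of $u$ is the nesting depth of $P$ in $u$, and $Q_n$ is the set of words of depth at most $n$. The order $>$ on $Q(X)$ is defined by recursion on $n$. On $X\cup P(Q_{n-1})$ (on $X$ if $n=0$), elements of $X$ are compared as in $X$, every $P(u)$ is greater than every $x\in X$, and $P(u)>P(v)$ iff $u>v$. For $u,v\in Q_n$, written $u=w_1^{i_1}\cdots w_t^{i_t}$ and $v=w_1^{j_1}\cdots w_t^{j_t}$ with factors $w_1>\cdots>w_t$ in $X\cup P(Q_{n-1})$ and $i_k,j_k\ge 0$, put $u>v$ iff $(\mathrm{bre}(u),i_1,\dots,i_t)>(\mathrm{bre}(v),j_1,\dots,j_t)$ lexicographically. Polynomials. Let $K[X;P]$ be the free $K$-module on $Q(X)$, with the product and $P$ extended linearly. The leading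 word $\bar f$ of a nonzero $f\in K[X;P]$ is the greatest word occurring in $f$ with nonzero coefficient. A $\star$-word is an element $u\in Q(X\cup\{\star\})$, $\star\notin X$, in which $\star$ occurs exactly once, and $u|_w$ denotes the result of replacing $\star$ by $w$ in $u$. Let $$S=\{P(u)P(v)-P(P(u)v)-P(uP(v))-\lambda P(uv)\mid u,v\in Q(X)\},$$ $$\mathrm{Irr}(S)=\{w\in Q(X)\mid w\ne u|_{\bar s}\text{ for all }\star\text{-words }u\text{ and all }s\in S\}.$$ Let $\mathrm{Id}(S)$ be the smallest ideal ($K$-submodule closed under multiplication by elements of $K[X;P]$ and under $P$) of $K[X;P]$ containing $S$, and $K[X;P|S]=K[X;P]/\mathrm{Id}(S)$, with the induced operator $P$. Commutative Rota–Baxter words. Let $CS(X)\subseteq Q(X)$ be the subsemigroup generated by $X$, $\Phi_0=CS(X)$, $$\Phi_{n+1}=\Phi_0\cup P(\Phi_n)\cup\{u\,P(v)\mid u\in\Phi_0,\ v\in\Phi_n\},\qquad \Phi(X)=\bigcup_{n\ge 0}\Phi_n.$$ Theorem. 1. $\mathrm{Irr}(S)=\Phi(X)$. 2. The classes of the words $w\in\Phi(X)$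 form a $K$-basis (indexed by $\Phi(X)$) of $K[X;P|S]$. 3. $K[X;P|S]$, with the operator $P$ and the map sending $x\in X$ to its class, is a free commutative Rota–Baxter algebra of weight $\lambda$ on $X$. That is, $P(a)P(b)=P(P(a)b)+P(aP(b))+\lambda P(ab)$ for all $a,b\in K[X;P|S]$, and for every commutative $K$-algebra $A$ with a $K$-linear operator $P_A$ satisfying the same identity and every map $f:X\to A$ there is exactly one $K$-algebra homomorphism $\varphi:K[X;P|S]\to A$ with $\varphi\circ P=P_A\circ\varphi$ and $\varphi([x])=f(x)$ for all $x\in X$. -/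

import Mathlib

/-! ### Commutative words with one unary operator -/

/-- Raw expressions in the generators `X`, a binary product and a unary operator symbol `P`. -/
inductive RawWord.{u} (X : Type u) : Type u
  | var (x : X) : RawWord X
  | op (t : RawWord X) : RawWord X
  | mul (s t : RawWord X) : RawWord X

/-- The congruence on raw expressions generated by commutativity and associativity of the
product. -/
inductive RawWord.Rel.{u} {X : Type u} : RawWord X → RawWord X → Prop
  | refl (a) : Rel a a
  | symm {a b} : Rel a b → Rel b a
  | trans {a b c} : Rel a b → Rel b c → Rel a c
  | op {a b} : Rel a b → Rel (RawWord.op a) (RawWord.op b)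
  | mul {a a' b b'} : Rel a a' → Rel b b' → Rel (RawWord.mul a b) (RawWord.mul a' b')
  | mul_comm (a b) : Rel (RawWord.mul a b) (RawWord.mul b a)
  | mul_assoc (a b c) :
      Rel (RawWord.mul (RawWord.mul a b) c) (RawWord.mul a (RawWord.mul b c))

/-- The setoid of expressions that are equal up to the order and bracketing of products. -/
def RawWord.setoid.{u} (X : Type u) : Setoid (RawWord X) where
  r := RawWord.Rel
  iseqv := ⟨RawWord.Rel.refl, RawWord.Rel.symm, RawWord.Rel.trans⟩

/-- `Q(X)`: the commutative words on `X` with one unary operator `P`.  There is no empty word. -/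
def OWord.{u} (X : Type u) : Type u := Quotient (RawWord.setoid X)

namespace OWord

/-- A generator as a word. -/
def var.{u} {X : Type u} (x : X) : OWord X := Quotient.mk (RawWord.setoid X) (RawWord.var x)

/-- The word `P(w)`. -/
def op.{u} {X : Type u} (w : OWord X) : OWord X :=
  Quotient.map (sa := RawWord.setoid X) (sb := RawWord.setoid X) RawWord.op
    (fun _ _ h => RawWord.Rel.op h) w

/-- The product of two words. -/
def mul.{u} {X : Type u} (v w : OWord X) : OWord X :=
  Quotient.map₂ (sa := RawWord.setoid X) (sb := RawWord.setoid X) (sc := RawWord.setoid X)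
    RawWord.mul (fun _ _ h _ _ h' => RawWord.Rel.mul h h') v w

instance instCommSemigroup.{u} {X : Type u} : CommSemigroup (OWord X) where
  mul := mul
  mul_assoc a b c := by
    induction a using Quotient.inductionOn
    induction b using Quotient.inductionOn
    induction c using Quotient.inductionOn
    exact Quotient.sound (s := RawWord.setoid X) (RawWord.Rel.mul_assoc _ _ _)
  mul_comm a b := by
    induction a using Quotient.inductionOn
    induction b using Quotient.inductionOn
    exact Quotient.sound (s := RawWord.setoid X) (RawWord.Rel.mul_comm _ _)

/-- Evaluation of raw expressions: `f` on generators, `p` for the operator, `m` for the product. -/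
def rawFold.{u, v} {X : Type u} {M : Type v} (f : X → M) (p : M → M) (m : M → M → M) :
    RawWord X → M
  | RawWord.var x => f x
  | RawWord.op t => p (rawFold f p m t)
  | RawWord.mul s t => m (rawFold f p m s) (rawFold f p m t)

/-- Recursion on words: `f` on generators, `p` for the operator, and a commutative and associative
operation `m` for the product. -/
def fold.{u, v} {X : Type u} {M : Type v} (f : X → M) (p : M → M) (m : M → M → M)
    (hc : ∀ a b, m a b = m b a) (ha : ∀ a b c, m (m a b) c = m a (m b c)) (w : OWord X) : M :=
  Quotient.lift (s := RawWord.setoid X) (rawFold f p m) (by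
    intro a b h
    change RawWord.Rel a b at h
    induction h with
    | refl => rfl
    | symm _ ih => exact ih.symm
    | trans _ _ ih1 ih2 => exact ih1.trans ih2
    | op _ ih => simp only [rawFold, ih]
    | mul _ _ ih1 ih2 => simp only [rawFold, ih1, ih2]
    | mul_comm a b => exact hc _ _
    | mul_assoc a b c => exact ha _ _ _) w

/-- The depth of a word (nesting of the operator). -/
def dep.{u} {X : Type u} (w : OWord X) : ℕ :=
  fold (fun _ => 0) (fun n => n + 1) max max_comm max_assoc w

/-- Computes the pair of `w` itself and its multiset of factors: `x` has the single factor `x`,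
encoded as `Sum.inl x`, `P(v)` has the single factor `P(v)`, encoded as `Sum.inr v`, and the factors
of a product are those of the two words together. -/
def foldFactors.{u} {X : Type u} (w : OWord X) : OWord X × Multiset (X ⊕ OWord X) :=
  fold (fun x => (var x, {Sum.inl x})) (fun a => (op a.1, {Sum.inr a.1}))
    (fun a b => (a.1 * b.1, a.2 + b.2))
    (fun a b => Prod.ext (mul_comm a.1 b.1) (add_comm a.2 b.2))
    (fun a b c => Prod.ext (mul_assoc a.1 b.1 c.1) (add_assoc a.2 b.2 c.2)) w

/-- The multiset of factors of `w` in its unique expression as a product of elements of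
`X ∪ P(Q(X))`; the factor `x` is encoded as `Sum.inl x` and the factor `P(v)` as `Sum.inr v`. -/
def factors.{u} {X : Type u} (w : OWord X) : Multiset (X ⊕ OWord X) := (foldFactors w).2

/-- The breadth of a word: its number of factors. -/
def bre.{u} {X : Type u} (w : OWord X) : ℕ := Multiset.card (factors w)

/-! ### The order on words -/

open Classical in
/-- Degree-lexicographic comparison `u > v` of words over an order `r` (`r a b` means `a > b`) on
the factors: compare breadths; if they agree, compare the multiplicities of the factors, beginning
with the greatest factor. -/
def DegLexGt.{u} {X : Type u} (r : X ⊕ OWord X → X ⊕ OWord X → Prop) (u v : OWord X) : Prop :=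
  bre v < bre u ∨
    (bre u = bre v ∧ ∃ w : X ⊕ OWord X, (factors v).count w < (factors u).count w ∧
      ∀ w', r w' w → (factors u).count w' = (factors v).count w')

/-- The order `a > b` on `X ∪ P(Q_{n-1})` (on `X` if `n = 0`), by recursion on `n`: elements of
`X` are compared as in `X`, every `P(u)` is greater than every element of `X`, and
`P(u) > P(v)` iff `u > v`. -/
def FactorGt.{u} {X : Type u} [LinearOrder X] : ℕ → X ⊕ OWord X → X ⊕ OWord X → Prop
  | _, Sum.inl x, Sum.inl y => y < x
  | _, Sum.inr _, Sum.inl _ => True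
  | _, Sum.inl _, Sum.inr _ => False
  | 0, Sum.inr _, Sum.inr _ => False
  | n + 1, Sum.inr u, Sum.inr v => DegLexGt (FactorGt n) u v

/-- The order `u > v` on words.  Both words have depth at most `n = max (dep u) (dep v)`, and they
are compared in the degree-lexicographic order of the words of depth at most `n`. -/
def Gt.{u} {X : Type u} [LinearOrder X] (u v : OWord X) : Prop :=
  DegLexGt (FactorGt (max (dep u) (dep v))) u v

/-! ### Words with a hole -/

/-- Number of occurrences of the hole `⋆ = none` in a word on `X ∪ {⋆}`. -/
def holes.{u} {X : Type u} (w : OWord (Option X)) : ℕ :=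
  fold (fun o => o.elim 1 (fun _ => 0)) id (· + ·) add_comm add_assoc w

/-- `Q^⋆(X)`: words on `X ∪ {⋆}` with exactly one occurrence of `⋆`. -/
def StarWord.{u} (X : Type u) : Type u := {w : OWord (Option X) // holes w = 1}

/-- `u|_w`: the word obtained from the star word `u` by replacing `⋆` with the word `w`. -/
def StarWord.subst.{u} {X : Type u} (u : StarWord X) (w : OWord X) : OWord X :=
  fold (fun o => o.elim w var) op (· * ·) mul_comm mul_assoc u.1

end OWord

/-! ### Polynomials, leading words, irreducible words -/

/-- `K[X; P]`: the free `K`-module on `Q(X)` with the product extended bilinearly. -/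
abbrev OPoly.{u, v} (K : Type u) [CommRing K] (X : Type v) : Type (max u v) :=
  MonoidAlgebra K (OWord X)

namespace OPoly

/-- A word as a polynomial. -/
noncomputable def word.{u, v} (K : Type u) [CommRing K] {X : Type v} (w : OWord X) : OPoly K X :=
  MonoidAlgebra.single w 1

/-- The linear extension of `w ↦ P(w)` to `K[X; P]`. -/
noncomputable def P.{u, v} (K : Type u) [CommRing K] (X : Type v) : OPoly K X →ₗ[K] OPoly K X :=
  MonoidAlgebra.mapDomainLinearMap K K OWord.op

/-- `w` is the leading word of `f` with respect to the order `gt` (`gt a b` means `a > b`): it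
occurs in `f` and is greater than all other words that occur in `f`. -/
def IsLeadingWord.{u, v} {K : Type u} [CommRing K] {X : Type v}
    (gt : OWord X → OWord X → Prop) (f : OPoly K X) (w : OWord X) : Prop :=
  w ∈ f.coeff.support ∧ ∀ v ∈ f.coeff.support, v ≠ w → gt w v

/-- `Irr(S)`: the words that are not of the form `u|_m` with `u` a star word and `m` the leading
word of some `s ∈ S`. -/
def Irr.{u, v} {K : Type u} [CommRing K] {X : Type v}
    (gt : OWord X → OWord X → Prop) (S : Set (OPoly K X)) : Set (OWord X) :=
  {w | ∀ (u : OWord.StarWord X), ∀ s ∈ S, ∀ m, IsLeadingWord gt s m → w ≠ u.subst m}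

/-- The set of polynomials `P(u)P(v) - P(P(u)v) - P(uP(v)) - lam P(uv)`, for words `u`, `v`. -/
def rotaBaxterRelations.{u, v} {K : Type u} [CommRing K] (X : Type v) (lam : K) :
    Set (OPoly K X) :=
  {f | ∃ u v : OWord X, f = P K X (word K u) * P K X (word K v)
      - P K X (P K X (word K u) * word K v) - P K X (word K u * P K X (word K v))
      - lam • P K X (word K u * word K v)}

/-- `I` is an ideal of `K[X; P]` as an algebra with operator: a submodule closed under
multiplication by arbitrary elements and under `P`. -/
def IsOperatedIdeal.{u, v} {K : Type u} [CommRing K] {X : Type v}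
    (I : Submodule K (OPoly K X)) : Prop :=
  (∀ a, ∀ b ∈ I, a * b ∈ I) ∧ ∀ b ∈ I, P K X b ∈ I

/-- `Id(S)`: the smallest operated ideal of `K[X; P]` that contains `S`. -/
noncomputable def Id.{u, v} {K : Type u} [CommRing K] {X : Type v} (S : Set (OPoly K X)) :
    Submodule K (OPoly K X) :=
  sInf {I | IsOperatedIdeal I ∧ S ⊆ I}

theorem isOperatedIdeal_Id.{u, v} {K : Type u} [CommRing K] {X : Type v} (S : Set (OPoly K X)) :
    IsOperatedIdeal (Id S) := by
  refine ⟨fun a b hb => ?_, fun b hb => ?_⟩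
  · simp only [Id, Submodule.mem_sInf] at hb ⊢
    exact fun I hI => hI.1.1 a b (hb I hI)
  · simp only [Id, Submodule.mem_sInf] at hb ⊢
    exact fun I hI => hI.1.2 b (hb I hI)

end OPoly

/-- `K[X; P | S] = K[X; P] / Id(S)`. -/
abbrev OQuot.{u, v} {K : Type u} [CommRing K] {X : Type v} (S : Set (OPoly K X)) :
    Type (max u v) :=
  OPoly K X ⧸ OPoly.Id S

namespace OQuot

/-- The class of a polynomial in `K[X; P | S]`. -/
noncomputable def mk.{u, v} {K : Type u} [CommRing K] {X : Type v} (S : Set (OPoly K X)) :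
    OPoly K X →ₗ[K] OQuot S :=
  (OPoly.Id S).mkQ

/-- The product of classes, `[a] [b] = [a b]`. -/
noncomputable instance instMul.{u, v} {K : Type u} [CommRing K] {X : Type v} (S : Set (OPoly K X)) :
    Mul (OQuot S) where
  mul := Quotient.map₂ (· * ·) (by
    intro a a' h b b' h'
    have h1 : a - a' ∈ OPoly.Id S := (Submodule.quotientRel_def _).1 h
    have h2 : b - b' ∈ OPoly.Id S := (Submodule.quotientRel_def _).1 h'
    refine (Submodule.quotientRel_def _).2 ?_
    have h3 := (OPoly.isOperatedIdeal_Id S).1 b _ h1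
    have h4 := (OPoly.isOperatedIdeal_Id S).1 a' _ h2
    have h5 : a * b - a' * b' = b * (a - a') + a' * (b - b') := by
      rw [mul_sub, mul_sub, mul_comm b a, mul_comm b a']
      abel
    change a * b - a' * b' ∈ OPoly.Id S
    rw [h5]
    exact Submodule.add_mem _ h3 h4)

theorem mk_mul.{u, v} {K : Type u} [CommRing K] {X : Type v} (S : Set (OPoly K X))
    (a b : OPoly K X) : mk S (a * b) = mk S a * mk S b := rfl

theorem mk_surjective.{u, v} {K : Type u} [CommRing K] {X : Type v} (S : Set (OPoly K X)) :
    Function.Surjective (mk S) := Submodule.mkQ_surjective _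

noncomputable instance instNonUnitalCommRing.{u, v} {K : Type u} [CommRing K] {X : Type v}
    (S : Set (OPoly K X)) : NonUnitalCommRing (OQuot S) where
  __ := (inferInstance : AddCommGroup (OQuot S))
  __ := instMul S
  left_distrib a b c := by
    obtain ⟨a, rfl⟩ := mk_surjective S a
    obtain ⟨b, rfl⟩ := mk_surjective S b
    obtain ⟨c, rfl⟩ := mk_surjective S c
    change mk S a * (mk S b + mk S c) = mk S a * mk S b + mk S a * mk S c
    rw [← map_add, ← mk_mul, mul_add, map_add, mk_mul, mk_mul]
  right_distrib a b c := by
    obtain ⟨a, rfl⟩ := mk_surjective S a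
    obtain ⟨b, rfl⟩ := mk_surjective S b
    obtain ⟨c, rfl⟩ := mk_surjective S c
    change (mk S a + mk S b) * mk S c = mk S a * mk S c + mk S b * mk S c
    rw [← map_add, ← mk_mul, add_mul, map_add, mk_mul, mk_mul]
  zero_mul a := by
    obtain ⟨a, rfl⟩ := mk_surjective S a
    change (0 : OQuot S) * mk S a = 0
    rw [← map_zero (mk S), ← mk_mul, zero_mul]
  mul_zero a := by
    obtain ⟨a, rfl⟩ := mk_surjective S a
    change mk S a * (0 : OQuot S) = 0
    rw [← map_zero (mk S), ← mk_mul, mul_zero]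
  mul_assoc a b c := by
    obtain ⟨a, rfl⟩ := mk_surjective S a
    obtain ⟨b, rfl⟩ := mk_surjective S b
    obtain ⟨c, rfl⟩ := mk_surjective S c
    change mk S a * mk S b * mk S c = mk S a * (mk S b * mk S c)
    rw [← mk_mul, ← mk_mul, ← mk_mul, ← mk_mul, mul_assoc]
  mul_comm a b := by
    obtain ⟨a, rfl⟩ := mk_surjective S a
    obtain ⟨b, rfl⟩ := mk_surjective S b
    change mk S a * mk S b = mk S b * mk S a
    rw [← mk_mul, ← mk_mul, mul_comm]

noncomputable instance instIsScalarTower.{u, v} {K : Type u} [CommRing K] {X : Type v}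
    (S : Set (OPoly K X)) : IsScalarTower K (OQuot S) (OQuot S) where
  smul_assoc k a b := by
    obtain ⟨a, rfl⟩ := mk_surjective S a
    obtain ⟨b, rfl⟩ := mk_surjective S b
    change (k • mk S a) * mk S b = k • (mk S a * mk S b)
    rw [← map_smul, ← mk_mul, ← mk_mul, smul_mul_assoc, map_smul]

noncomputable instance instSMulCommClass.{u, v} {K : Type u} [CommRing K] {X : Type v}
    (S : Set (OPoly K X)) : SMulCommClass K (OQuot S) (OQuot S) where
  smul_comm k a b := by
    obtain ⟨a, rfl⟩ := mk_surjective S a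
    obtain ⟨b, rfl⟩ := mk_surjective S b
    change k • (mk S a * mk S b) = mk S a * (k • mk S b)
    rw [← map_smul, ← mk_mul, ← mk_mul, mul_smul_comm, map_smul]

/-- The operator induced by `P` on `K[X; P | S]`, `P [a] = [P a]`. -/
noncomputable def P.{u, v} {K : Type u} [CommRing K] {X : Type v} (S : Set (OPoly K X)) :
    OQuot S →ₗ[K] OQuot S :=
  (OPoly.Id S).mapQ (OPoly.Id S) (OPoly.P K X) (OPoly.isOperatedIdeal_Id S).2

/-- The class of a word in `K[X; P | S]`. -/
noncomputable def ofWord.{u, v} {K : Type u} [CommRing K] {X : Type v} (S : Set (OPoly K X))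
    (w : OWord X) : OQuot S :=
  mk S (OPoly.word K w)

end OQuot

/-! ### Commutative Rota-Baxter words and algebras -/

namespace OWord

/-- `CS(X)`: the subsemigroup of `Q(X)` generated by `X`. -/
def CS.{u} (X : Type u) : Set (OWord X) :=
  (Subsemigroup.closure (Set.range (var (X := X))) : Subsemigroup (OWord X))

/-- `Φ_0 = CS(X)` and `Φ_{n+1} = Φ_0 ∪ P(Φ_n) ∪ Φ_0 P(Φ_n)`. -/
def PhiLevel.{u} (X : Type u) : ℕ → Set (OWord X)
  | 0 => CS X
  | n + 1 => CS X ∪ op '' PhiLevel X n ∪ Set.image2 (fun u v => u * op v) (CS X) (PhiLevel X n)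

/-- `Φ(X)`: the commutative Rota-Baxter words on `X`. -/
def Phi.{u} (X : Type u) : Set (OWord X) := ⋃ n, PhiLevel X n

end OWord

/-- The linear operator `p` on the (not necessarily unital) commutative `K`-algebra `A` is a
Rota-Baxter operator of weight `lam`. -/
def IsRotaBaxter.{u, v} {K : Type u} [CommRing K] (lam : K) {A : Type v} [NonUnitalCommRing A]
    [Module K A] (p : A →ₗ[K] A) : Prop :=
  ∀ a b : A, p a * p b = p (p a * b) + p (a * p b) + lam • p (a * b)

/-- `(F, p)`, with the map `i : X → F`, is a free commutative Rota-Baxter algebra of weight `lam` on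
`X` (tested against all commutative Rota-Baxter algebras in the universe `w`): it is a Rota-Baxter
algebra, and every map from `X` to a commutative Rota-Baxter algebra of weight `lam` extends
uniquely along `i` to a `K`-algebra homomorphism that commutes with the operators. -/
def IsFreeCommRotaBaxter.{w, u, v, t} {K : Type u} [CommRing K] (lam : K) {X : Type v} {F : Type t}
    [NonUnitalCommRing F] [Module K F] (p : F →ₗ[K] F) (i : X → F) : Prop :=
  IsRotaBaxter lam p ∧
    ∀ (A : Type w) [NonUnitalCommRing A] [Module K A] [IsScalarTower K A A] [SMulCommClass K A A]
      (q : A →ₗ[K] A), IsRotaBaxter lam q → ∀ f : X → A,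
        ∃! φ : F →ₙₐ[K] A, (∀ a, φ (p a) = q (φ a)) ∧ ∀ x, φ (i x) = f x

universe w u v

/-! Irreducibility is a matter of breadth. In a Rota-Baxter relation the word `P(u)P(v)` has breadth
2 and all other words have the form `P(w)`, of breadth 1; so `P(u)P(v)` leads, whatever happens
among words of equal breadth. Irreducible words are thus those in which no subword has two factors
`P(a)`, `P(b)`. These are the Rota-Baxter words: every word is in `Phi X` or reducible
(`mem_Phi_or_reducible`), and the invariant `opPairs` excludes both at once.

Freeness is formal: evaluation in a Rota-Baxter algebra kills the relations, and words are built
from variables by product and operator.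

The basis is obtained without a composition-diamond lemma. Rota-Baxter words span, because the
Rota-Baxter identity rewrites `P(a)P(b)` as `P` of products involving shorter words
(`ofWord_mul_mem_phiSpan`). For independence a concrete model is used. Let `M` be the free
commutative monoid on `X` and let lists over `M` span the quasi-shuffle algebra of weight `lam`.
Then `K[M]` tensored with this algebra carries the Rota-Baxter operator `a ⊗ s ↦ 1 ⊗ (a :: s)`,
since the recursion of the quasi-shuffle product is the Rota-Baxter identity (`cons_mul_cons`). The
homomorphism with `x ↦ x ⊗ 1` sends `m P(m₁ P(⋯ P(mₖ)))` to the single basis vector `m ⊗ [m₁, ...,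
mₖ]`, from which the word can be read off (`exists_toShuffle_eq`). -/

/-! ### The quasi-shuffle algebra -/

/-- The free `K`-module on lists over `M`, to be equipped with the quasi-shuffle product of
weight `lam`. -/
def QuasiShuffle (K : Type u) [CommRing K] (M : Type v) (_lam : K) : Type (max u v) :=
  List M →₀ K

namespace QuasiShuffle

variable {K : Type u} [CommRing K] {M : Type v} {lam : K}

noncomputable instance : AddCommGroup (QuasiShuffle K M lam) :=
  inferInstanceAs (AddCommGroup (List M →₀ K))

noncomputable instance : Module K (QuasiShuffle K M lam) :=
  inferInstanceAs (Module K (List M →₀ K))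

variable (lam) in
/-- The basis vector of a list. -/
noncomputable def of (s : List M) : QuasiShuffle K M lam := Finsupp.single s 1

/-- Linear extension of a function on lists. -/
noncomputable def lift {N : Type*} [AddCommGroup N] [Module K N] (f : List M → N) :
    QuasiShuffle K M lam →ₗ[K] N :=
  Finsupp.linearCombination K f

@[simp]
theorem lift_of {N : Type*} [AddCommGroup N] [Module K N] (f : List M → N) (s : List M) :
    lift f (of lam s) = f s :=
  (Finsupp.linearCombination_single K 1 s).trans (one_smul K _)

@[elab_as_elim]
theorem induction_linear {p : QuasiShuffle K M lam → Prop} (x : QuasiShuffle K M lam)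
    (zero : p 0) (add : ∀ x y, p x → p y → p (x + y))
    (smul : ∀ (c : K) x, p x → p (c • x)) (of : ∀ s, p (of lam s)) : p x := by
  refine Finsupp.induction_linear (motive := p) x zero add fun s c => ?_
  have h := smul c _ (of s)
  have h' : c • QuasiShuffle.of lam s = (Finsupp.single s c : List M →₀ K) := by
    change c • (Finsupp.single s 1 : List M →₀ K) = _
    rw [Finsupp.smul_single, smul_eq_mul, mul_one]
  rwa [h'] at h

/-- The coefficient of a list. -/
noncomputable def coeff (s : List M) : QuasiShuffle K M lam →ₗ[K] K := Finsupp.lapply s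

theorem coeff_of_self (s : List M) : coeff s (of lam s) = 1 :=
  Finsupp.single_eq_same

theorem coeff_of_ne {s t : List M} (h : t ≠ s) : coeff s (of lam t) = 0 :=
  Finsupp.single_eq_of_ne h.symm

/-- Prepending a letter. -/
noncomputable def cons (a : M) : QuasiShuffle K M lam →ₗ[K] QuasiShuffle K M lam :=
  lift fun s => of lam (a :: s)

@[simp]
theorem cons_of (a : M) (s : List M) : cons a (of lam s) = of lam (a :: s) := lift_of _ _

noncomputable instance : One (QuasiShuffle K M lam) := ⟨of lam []⟩

theorem one_eq : (1 : QuasiShuffle K M lam) = of lam [] := rfl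

variable [CommMonoid M]

variable (lam) in
/-- The quasi-shuffle product of two lists. -/
noncomputable def shuffle : List M → List M → QuasiShuffle K M lam
  | [], t => of lam t
  | a :: s, [] => of lam (a :: s)
  | a :: s, b :: t => cons a (shuffle s (b :: t)) + cons b (shuffle (a :: s) t) +
      lam • cons (a * b) (shuffle s t)
termination_by s t => s.length + t.length

/-- The quasi-shuffle product as a bilinear map. -/
noncomputable def mulLin :
    QuasiShuffle K M lam →ₗ[K] QuasiShuffle K M lam →ₗ[K] QuasiShuffle K M lam :=
  lift fun s => lift fun t => shuffle lam s t

noncomputable instance : Mul (QuasiShuffle K M lam) := ⟨fun x y => mulLin x y⟩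

theorem mul_eq (x y : QuasiShuffle K M lam) : x * y = mulLin x y := rfl

theorem of_mul_of (s t : List M) : of lam s * of lam t = shuffle lam s t := by
  simp [mul_eq, mulLin]

noncomputable instance : NonUnitalNonAssocRing (QuasiShuffle K M lam) where
  left_distrib a b c := by simp [mul_eq]
  right_distrib a b c := by simp [mul_eq]
  zero_mul a := by simp [mul_eq]
  mul_zero a := by simp [mul_eq]

instance : IsScalarTower K (QuasiShuffle K M lam) (QuasiShuffle K M lam) :=
  ⟨fun c x y => by simp [mul_eq]⟩

instance : SMulCommClass K (QuasiShuffle K M lam) (QuasiShuffle K M lam) :=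
  ⟨fun c x y => by simp [mul_eq]⟩

protected theorem mul_comm (x y : QuasiShuffle K M lam) : x * y = y * x := by
  induction x using induction_linear with
  | zero => rw [zero_mul, mul_zero]
  | add x x' h h' => rw [add_mul, mul_add, h, h']
  | smul c x h => rw [smul_mul_assoc, mul_smul_comm, h]
  | of s =>
    induction y using induction_linear with
    | zero => rw [zero_mul, mul_zero]
    | add y y' h h' => rw [add_mul, mul_add, h, h']
    | smul c y h => rw [smul_mul_assoc, mul_smul_comm, h]
    | of t =>
      rw [of_mul_of, of_mul_of]
      induction s generalizing t with
      | nil => cases t <;> simp [shuffle]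
      | cons a s ihs =>
        induction t with
        | nil => simp [shuffle]
        | cons b t iht =>
          rw [shuffle, shuffle, iht, ihs, ihs, mul_comm a b]
          abel

protected theorem one_mul (x : QuasiShuffle K M lam) : 1 * x = x := by
  rw [one_eq]
  induction x using induction_linear with
  | zero => rw [mul_zero]
  | add x x' h h' => rw [mul_add, h, h']
  | smul c x h => rw [mul_smul_comm, h]
  | of s => rw [of_mul_of, shuffle]

/-- Bilinear extension of the recursion that defines `shuffle`. Associativity and the Rota-Baxter
identity of the model both rest on it. -/
theorem cons_mul_cons (a b : M) (x y : QuasiShuffle K M lam) :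
    cons a x * cons b y =
      cons a (x * cons b y) + cons b (cons a x * y) + lam • cons (a * b) (x * y) := by
  induction x using induction_linear with
  | zero => simp
  | add x x' h h' => simp only [map_add, add_mul, h, h', smul_add]; abel
  | smul c x h =>
    simp only [map_smul, smul_mul_assoc, h, smul_add, smul_comm c lam]
  | of s =>
    induction y using induction_linear with
    | zero => simp
    | add y y' h h' => simp only [map_add, mul_add, h, h', smul_add]; abel
    | smul c y h =>
      simp only [map_smul, mul_smul_comm, h, smul_add, smul_comm c lam]
    | of t => simp only [cons_of, of_mul_of, shuffle]

/-- Both bracketings expand into seven terms, one for each nonempty set of heads among `a`, `b`, `c`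
merged into the first letter. Corresponding tails are triple products of smaller total length, so
the nested inductions identify them. -/
theorem of_mul_assoc (r s t : List M) :
    of lam r * of lam s * of lam t = of lam r * (of lam s * of lam t) := by
  induction r generalizing s t with
  | nil => simp only [← one_eq, QuasiShuffle.one_mul]
  | cons a r ihr =>
    induction s generalizing t with
    | nil => rw [← one_eq, QuasiShuffle.one_mul, QuasiShuffle.mul_comm _ 1, QuasiShuffle.one_mul]
    | cons b s ihs =>
      induction t with
      | nil => rw [← one_eq, QuasiShuffle.mul_comm _ 1, QuasiShuffle.one_mul,
          QuasiShuffle.mul_comm _ 1, QuasiShuffle.one_mul]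
      | cons c t iht =>
        have hr₁ := ihr (b :: s) (c :: t)
        have hr₂ := ihr s (c :: t)
        have hr₃ := ihr (b :: s) t
        have hr₄ := ihr s t
        have hs₁ := ihs (c :: t)
        have hs₂ := ihs t
        simp only [← cons_of] at hr₁ hr₂ hr₃ hs₁ hs₂ iht ⊢
        -- The plain expansion yields three terms with first letter `c`; by `cons_mul_cons` they
        -- recombine into one. In `hr` the same happens with first letter `a`.
        have hl : cons a (of lam r) * cons b (of lam s) * cons c (of lam t) =
            cons a (of lam r * cons b (of lam s) * cons c (of lam t)) +
            cons b (cons a (of lam r) * of lam s * cons c (of lam t)) +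
            cons c (cons a (of lam r) * cons b (of lam s) * of lam t) +
            lam • (cons (a * b) (of lam r * of lam s * cons c (of lam t)) +
              cons (a * c) (of lam r * cons b (of lam s) * of lam t) +
              cons (b * c) (cons a (of lam r) * of lam s * of lam t)) +
            lam • lam • cons (a * b * c) (of lam r * of lam s * of lam t) := by
          rw [cons_mul_cons a b]
          simp only [add_mul, smul_mul_assoc, cons_mul_cons, map_add, map_smul, smul_add]
          abel
        have hr : cons a (of lam r) * (cons b (of lam s) * cons c (of lam t)) =
            cons a (of lam r * (cons b (of lam s) * cons c (of lam t))) +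
            cons b (cons a (of lam r) * (of lam s * cons c (of lam t))) +
            cons c (cons a (of lam r) * (cons b (of lam s) * of lam t)) +
            lam • (cons (a * b) (of lam r * (of lam s * cons c (of lam t))) +
              cons (a * c) (of lam r * (cons b (of lam s) * of lam t)) +
              cons (b * c) (cons a (of lam r) * (of lam s * of lam t))) +
            lam • lam • cons (a * b * c) (of lam r * (of lam s * of lam t)) := by
          rw [cons_mul_cons b c]
          simp only [mul_add, mul_smul_comm, cons_mul_cons, map_add, map_smul, smul_add, mul_assoc]
          abel
        rw [hl, hr, hr₁, hr₂, hr₃, hr₄, hs₁, hs₂, iht]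

protected theorem mul_assoc (x y z : QuasiShuffle K M lam) : x * y * z = x * (y * z) := by
  induction x using induction_linear with
  | zero => simp
  | add x x' h h' => simp only [add_mul, h, h']
  | smul c x h => simp only [smul_mul_assoc, h]
  | of r =>
    induction y using induction_linear with
    | zero => simp
    | add y y' h h' => simp only [mul_add, add_mul, h, h']
    | smul c y h => simp only [mul_smul_comm, smul_mul_assoc, h]
    | of s =>
      induction z using induction_linear with
      | zero => simp
      | add z z' h h' => simp only [mul_add, h, h']
      | smul c z h => simp only [mul_smul_comm, h]
      | of t => exact of_mul_assoc r s t

noncomputable instance : CommRing (QuasiShuffle K M lam) where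
  __ := (inferInstance : NonUnitalNonAssocRing (QuasiShuffle K M lam))
  mul_assoc := QuasiShuffle.mul_assoc
  mul_comm := QuasiShuffle.mul_comm
  one_mul := QuasiShuffle.one_mul
  mul_one x := by rw [QuasiShuffle.mul_comm, QuasiShuffle.one_mul]

/-! ### The Rota-Baxter operator built from the quasi-shuffle product -/

variable (K M lam) in
/-- The operator `a ⊗ s ↦ 1 ⊗ (a :: s)` on `K[M] ⊗ QuasiShuffle K M lam`. -/
noncomputable def rotaBaxter :
    MonoidAlgebra (QuasiShuffle K M lam) M →ₗ[K] MonoidAlgebra (QuasiShuffle K M lam) M where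
  toFun f := f.coeff.sum fun a x => MonoidAlgebra.single 1 (cons a x)
  map_add' f g := by
    rw [MonoidAlgebra.coeff_add, Finsupp.sum_add_index'] <;> simp
  map_smul' c f := by
    rw [MonoidAlgebra.coeff_smul, Finsupp.sum_smul_index'] <;> simp [Finsupp.smul_sum]

@[simp]
theorem rotaBaxter_single (a : M) (x : QuasiShuffle K M lam) :
    rotaBaxter K M lam (MonoidAlgebra.single a x) = MonoidAlgebra.single 1 (cons a x) := by
  simp [rotaBaxter]

/-- On `a ⊗ x` and `b ⊗ y` the operator values have monoid component `1`, so in `P(P(a ⊗ x)(b ⊗ y))`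
only `b` is prepended, to `cons a x * y`. The identity becomes `cons_mul_cons`. -/
theorem isRotaBaxter_rotaBaxter : IsRotaBaxter lam (rotaBaxter K M lam) := by
  intro f g
  induction f using MonoidAlgebra.induction_linear with
  | zero => simp
  | add f f' h h' => simp only [map_add, add_mul, h, h', smul_add]; abel
  | single a x =>
    induction g using MonoidAlgebra.induction_linear with
    | zero => simp
    | add g g' h h' => simp only [map_add, mul_add, h, h', smul_add]; abel
    | single b y =>
      simp only [rotaBaxter_single, MonoidAlgebra.single_mul_single, one_mul, mul_one,
        cons_mul_cons, MonoidAlgebra.smul_single, MonoidAlgebra.single_add]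
      abel

end QuasiShuffle

/-! ### Words -/

namespace OWord

variable {X : Type v}

@[elab_as_elim]
theorem induction {p : OWord X → Prop} (w : OWord X) (var : ∀ x, p (var x))
    (op : ∀ w, p w → p (op w)) (mul : ∀ v w, p v → p w → p (v * w)) : p w := by
  induction w using Quotient.inductionOn with
  | h t =>
    induction t with
    | var x => exact var x
    | op t ih => exact op _ ih
    | mul s t ihs iht => exact mul _ _ ihs iht

section fold

variable {M : Type*} (f : X → M) (p : M → M) (m : M → M → M)
  (hc : ∀ a b, m a b = m b a) (ha : ∀ a b c, m (m a b) c = m a (m b c))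

theorem fold_var (x : X) : fold f p m hc ha (var x) = f x := rfl

theorem fold_op (w : OWord X) : fold f p m hc ha (op w) = p (fold f p m hc ha w) := by
  induction w using Quotient.inductionOn; rfl

theorem fold_mul (v w : OWord X) :
    fold f p m hc ha (v * w) = m (fold f p m hc ha v) (fold f p m hc ha w) := by
  induction v using Quotient.inductionOn
  induction w using Quotient.inductionOn
  rfl

end fold

theorem bre_op (w : OWord X) : bre (op w) = 1 := by
  simp [bre, factors, foldFactors, fold_op]

theorem bre_mul (v w : OWord X) : bre (v * w) = bre v + bre w := by
  simp [bre, factors, foldFactors, fold_mul]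

/-! ### Reducible words and an invariant that detects them -/

/-- The first component counts the factors `P(u)` of a word, the second one the pairs of such
factors that occur as factors of a common subword. -/
def opPairs (w : OWord X) : ℕ × ℕ :=
  fold (fun _ => (0, 0)) (fun a => (1, a.2)) (fun a b => (a.1 + b.1, a.2 + b.2 + a.1 * b.1))
    (fun a b => Prod.ext (by simp only; ring) (by simp only; ring))
    (fun a b c => Prod.ext (by simp only; ring) (by simp only; ring)) w

theorem opPairs_op (w : OWord X) : opPairs (op w) = (1, (opPairs w).2) := fold_op ..

theorem opPairs_mul (v w : OWord X) : opPairs (v * w) =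
    ((opPairs v).1 + (opPairs w).1,
      (opPairs v).2 + (opPairs w).2 + (opPairs v).1 * (opPairs w).1) := fold_mul ..

/-- The words `u|_{P(a)P(b)}`. -/
def Reducible (w : OWord X) : Prop :=
  ∃ (u : StarWord X) (a b : OWord X), w = u.subst (op a * op b)

theorem holes_op (w : OWord (Option X)) : holes (op w) = holes w := fold_op ..

theorem holes_mul (v w : OWord (Option X)) : holes (v * w) = holes v + holes w := fold_mul ..

/-- A word as a word with no hole. -/
def noHole (w : OWord X) : OWord (Option X) :=
  fold (fun x => var (some x)) op (· * ·) mul_comm mul_assoc w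

theorem holes_noHole (w : OWord X) : holes (noHole w) = 0 := by
  induction w using induction with
  | var x => rfl
  | op w ih => rw [noHole, fold_op, holes_op]; exact ih
  | mul v w ihv ihw => rw [noHole, fold_mul, holes_mul]; exact congrArg₂ (· + ·) ihv ihw

theorem fold_noHole (s w : OWord X) :
    fold (fun o : Option X => o.elim s var) op (· * ·) mul_comm mul_assoc (noHole w) = w := by
  induction w using induction with
  | var x => rfl
  | op w ih => rw [noHole, fold_op, fold_op]; exact congrArg op ih
  | mul v w ihv ihw => rw [noHole, fold_mul, fold_mul]; exact congrArg₂ (· * ·) ihv ihw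

theorem reducible_op_mul_op (a b : OWord X) : Reducible (op a * op b) :=
  ⟨⟨var none, rfl⟩, a, b, rfl⟩

theorem Reducible.op {w : OWord X} (h : Reducible w) : Reducible (op w) := by
  obtain ⟨⟨u, hu⟩, a, b, rfl⟩ := h
  exact ⟨⟨OWord.op u, by rw [holes_op, hu]⟩, a, b, (fold_op ..).symm⟩

theorem Reducible.mul_right {v : OWord X} (h : Reducible v) (w : OWord X) :
    Reducible (v * w) := by
  obtain ⟨⟨u, hu⟩, a, b, rfl⟩ := h
  refine ⟨⟨u * noHole w, by rw [holes_mul, hu, holes_noHole]⟩, a, b, ?_⟩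
  simp only [StarWord.subst, fold_mul, fold_noHole]

theorem Reducible.mul_left {w : OWord X} (h : Reducible w) (v : OWord X) :
    Reducible (v * w) := mul_comm w v ▸ h.mul_right v

theorem Reducible.opPairs_pos {w : OWord X} (h : Reducible w) : 0 < (opPairs w).2 := by
  obtain ⟨⟨u, hu⟩, a, b, rfl⟩ := h
  simp only [StarWord.subst]
  -- At least one hole suffices, and some factor of a product inherits this.
  replace hu : 0 < holes u := by omega
  induction u using induction with
  | var o =>
    cases o with
    | none => simp [fold_var, opPairs_mul, opPairs_op]
    | some x => exact absurd hu (lt_irrefl 0)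
  | op u ih =>
    rw [fold_op, opPairs_op]
    exact ih (holes_op u ▸ hu)
  | mul u v ihu ihv =>
    rw [holes_mul] at hu
    rw [fold_mul, opPairs_mul]
    obtain h | h : 0 < holes u ∨ 0 < holes v := by omega
    · have := ihu h
      simp only; omega
    · have := ihv h
      simp only; omega

/-! ### Commutative Rota-Baxter words -/

theorem var_mem_CS (x : X) : var x ∈ CS X := Subsemigroup.subset_closure ⟨x, rfl⟩

theorem mul_mem_CS {u v : OWord X} (hu : u ∈ CS X) (hv : v ∈ CS X) : u * v ∈ CS X :=
  Subsemigroup.mul_mem _ hu hv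

@[elab_as_elim]
theorem CS_induction {p : ∀ u : OWord X, u ∈ CS X → Prop} {u : OWord X} (hu : u ∈ CS X)
    (var : ∀ x, p (var x) (var_mem_CS x))
    (mul : ∀ v w (hv : v ∈ CS X) (hw : w ∈ CS X), p v hv → p w hw → p (v * w) (mul_mem_CS hv hw)) :
    p u hu :=
  Subsemigroup.closure_induction (p := p) (fun _ ⟨x, hx⟩ => by subst hx; exact var x) mul hu

theorem CS_subset_Phi : CS X ⊆ Phi X := fun _ h => Set.mem_iUnion.2 ⟨0, h⟩

theorem op_mem_Phi {w : OWord X} (h : w ∈ Phi X) : op w ∈ Phi X := by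
  obtain ⟨n, hn⟩ := Set.mem_iUnion.1 h
  exact Set.mem_iUnion.2 ⟨n + 1, .inl (.inr ⟨w, hn, rfl⟩)⟩

theorem mul_op_mem_Phi {u w : OWord X} (hu : u ∈ CS X) (h : w ∈ Phi X) : u * op w ∈ Phi X := by
  obtain ⟨n, hn⟩ := Set.mem_iUnion.1 h
  exact Set.mem_iUnion.2 ⟨n + 1, .inr ⟨u, hu, w, hn, rfl⟩⟩

@[elab_as_elim]
theorem Phi_induction {p : ∀ w : OWord X, w ∈ Phi X → Prop} {w : OWord X} (hw : w ∈ Phi X)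
    (base : ∀ u (hu : u ∈ CS X), p u (CS_subset_Phi hu))
    (op : ∀ v (hv : v ∈ Phi X), p v hv → p (op v) (op_mem_Phi hv))
    (mul_op : ∀ u (hu : u ∈ CS X) v (hv : v ∈ Phi X), p v hv →
      p (u * OWord.op v) (mul_op_mem_Phi hu hv)) : p w hw := by
  obtain ⟨n, hn⟩ := Set.mem_iUnion.1 hw
  induction n generalizing w with
  | zero => exact base w hn
  | succ n ih =>
    obtain (h | ⟨v, hv, rfl⟩) | ⟨u, hu, v, hv, rfl⟩ := hn
    · exact base w h
    · exact op v (Set.mem_iUnion.2 ⟨n, hv⟩) (ih _ hv)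
    · exact mul_op u hu v (Set.mem_iUnion.2 ⟨n, hv⟩) (ih _ hv)

theorem CS_mul_mem_Phi {u w : OWord X} (hu : u ∈ CS X) (hw : w ∈ Phi X) : u * w ∈ Phi X := by
  induction hw using Phi_induction with
  | base v hv => exact CS_subset_Phi (mul_mem_CS hu hv)
  | op v hv => exact mul_op_mem_Phi hu hv
  | mul_op v hv w hw => rw [← mul_assoc]; exact mul_op_mem_Phi (mul_mem_CS hu hv) hw

theorem opPairs_of_mem_CS {u : OWord X} (hu : u ∈ CS X) : opPairs u = (0, 0) := by
  induction hu using CS_induction with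
  | var x => rfl
  | mul v w _ _ hv hw => simp [opPairs_mul, hv, hw]

theorem opPairs_of_mem_Phi {w : OWord X} (hw : w ∈ Phi X) : (opPairs w).2 = 0 := by
  induction hw using Phi_induction with
  | base u hu => rw [opPairs_of_mem_CS hu]
  | op v _ ih => rw [opPairs_op, ih]
  | mul_op u hu v _ ih => simp [opPairs_mul, opPairs_of_mem_CS hu, opPairs_op, ih]

/-- A Rota-Baxter word has at most one factor of the form `P(a)`. In a product of two such words,
either at most one factor of this form remains, or two of them can be brought together by
commutativity. -/
theorem mem_Phi_or_reducible (w : OWord X) : w ∈ Phi X ∨ Reducible w := by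
  induction w using induction with
  | var x => exact .inl (CS_subset_Phi (var_mem_CS x))
  | op w ih => exact ih.imp op_mem_Phi Reducible.op
  | mul v w ihv ihw =>
    obtain hv | hv := ihv
    swap
    · exact .inr (hv.mul_right w)
    obtain hw | hw := ihw
    swap
    · exact .inr (hw.mul_left v)
    induction hv using Phi_induction with
    | base u hu => exact .inl (CS_mul_mem_Phi hu hw)
    | op a ha =>
      induction hw using Phi_induction with
      | base u hu => exact .inl (mul_comm u _ ▸ mul_op_mem_Phi hu ha)
      | op b => exact .inr (reducible_op_mul_op a b)
      | mul_op u _ b =>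
        exact .inr (mul_left_comm u (op a) _ ▸ (reducible_op_mul_op a b).mul_left u)
    | mul_op u hu a ha =>
      induction hw using Phi_induction with
      | base u' hu' => exact .inl (mul_comm u' _ ▸ CS_mul_mem_Phi hu' (mul_op_mem_Phi hu ha))
      | op b => exact .inr (mul_assoc u (op a) _ ▸ (reducible_op_mul_op a b).mul_left u)
      | mul_op u' _ b =>
        exact .inr (mul_mul_mul_comm u u' (op a) (op b) ▸
          (reducible_op_mul_op a b).mul_left (u * u'))

theorem not_reducible_iff_mem_Phi {w : OWord X} : ¬ Reducible w ↔ w ∈ Phi X :=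
  ⟨fun h => (mem_Phi_or_reducible w).resolve_right h,
    fun h h' => h'.opPairs_pos.ne' (opPairs_of_mem_Phi h)⟩

end OWord

/-! ### Leading words of the Rota-Baxter relations -/

namespace OPoly

open OWord

variable {K : Type u} [CommRing K] {X : Type v}

theorem P_word (w : OWord X) : P K X (word K w) = word K (op w) :=
  MonoidAlgebra.mapDomainLinearMap_single ..

theorem word_mul_word (v w : OWord X) : word K v * word K w = word K (v * w) := by
  simp [word]

/-- The relation `P(u)P(v) - P(P(u)v) - P(uP(v)) - lam P(uv)`. -/
noncomputable def relation (lam : K) (u v : OWord X) : OPoly K X :=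
  word K (op u * op v) - word K (op (op u * v)) - word K (op (u * op v)) - lam • word K (op (u * v))

theorem mem_rotaBaxterRelations {lam : K} {f : OPoly K X} :
    f ∈ rotaBaxterRelations X lam ↔ ∃ u v, f = relation lam u v := by
  simp only [rotaBaxterRelations, Set.mem_ofPred_eq, P_word, word_mul_word, relation]

/-- The three subtracted words have breadth 1, so coincidences among them (for example when `u = v`)
do not affect other coefficients. -/
theorem coeff_relation_of_bre_ne_one (lam : K) (u v : OWord X) {w : OWord X} (h : bre w ≠ 1) :
    (relation lam u v).coeff w = (word K (op u * op v)).coeff w := by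
  have hw : ∀ a, (word K (op a)).coeff w = 0 := fun a =>
    Finsupp.single_eq_of_ne fun e => h (e ▸ bre_op a)
  have e : (relation lam u v).coeff w = (word K (op u * op v)).coeff w -
      (word K (op (op u * v))).coeff w - (word K (op (u * op v))).coeff w -
      lam • (word K (op (u * v))).coeff w := rfl
  rw [e, hw, hw, hw]
  simp

theorem isLeadingWord_relation_iff [Nontrivial K] [LinearOrder X] (lam : K) (u v m : OWord X) :
    IsLeadingWord OWord.Gt (relation lam u v) m ↔ m = op u * op v := by
  have h2 : bre (op u * op v) = 2 := by rw [bre_mul, bre_op, bre_op]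
  have hmem : op u * op v ∈ (relation lam u v).coeff.support := by
    rw [Finsupp.mem_support_iff, coeff_relation_of_bre_ne_one lam u v (by omega)]
    simp [word]
  have hbre : ∀ w ∈ (relation lam u v).coeff.support, w ≠ op u * op v → bre w = 1 := by
    intro w hw hne
    by_contra h
    rw [Finsupp.mem_support_iff, coeff_relation_of_bre_ne_one lam u v h] at hw
    exact hw (Finsupp.single_eq_of_ne hne)
  constructor
  · rintro ⟨hm, hgt⟩
    by_contra hne
    have h1 := hbre m hm hne
    -- A leading word `m` of breadth 1 would have to exceed a word of breadth 2.
    obtain h | ⟨h, _⟩ := hgt _ hmem (Ne.symm hne) <;> omega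
  · rintro rfl
    exact ⟨hmem, fun w hw hne => .inl (by rw [hbre w hw hne, h2]; omega)⟩

theorem irr_rotaBaxterRelations [Nontrivial K] [LinearOrder X] (lam : K) :
    Irr OWord.Gt (rotaBaxterRelations X lam) = Phi X := by
  ext w
  rw [← not_reducible_iff_mem_Phi]
  constructor
  · rintro h ⟨s, a, b, hw⟩
    exact h s _ (mem_rotaBaxterRelations.2 ⟨a, b, rfl⟩) _
      ((isLeadingWord_relation_iff lam a b _).2 rfl) hw
  · rintro h s f hf m hm hw
    obtain ⟨a, b, rfl⟩ := mem_rotaBaxterRelations.1 hf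
    rw [isLeadingWord_relation_iff] at hm
    exact h ⟨s, a, b, hm ▸ hw⟩

end OPoly

/-! ### Evaluation of polynomials in operated algebras -/

namespace OPoly

open OWord

variable {K : Type u} [CommRing K] {X : Type v} {A : Type w} [NonUnitalCommRing A] [Module K A]
  [IsScalarTower K A A] [SMulCommClass K A A] (q : A →ₗ[K] A) (f : X → A)

/-- The value of a word in a commutative algebra with operator. -/
def wordEval : OWord X →ₙ* A where
  toFun := fold f q (· * ·) mul_comm mul_assoc
  map_mul' _ _ := fold_mul ..

/-- The value of a polynomial in a commutative algebra with operator. -/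
noncomputable def eval : OPoly K X →ₙₐ[K] A :=
  MonoidAlgebra.liftMagma K (wordEval q f)

theorem eval_word (w : OWord X) : eval q f (word K w) = wordEval q f w := by
  simp [eval, word]

@[elab_as_elim]
theorem induction_word {p : OPoly K X → Prop} (a : OPoly K X) (zero : p 0)
    (add : ∀ a b, p a → p b → p (a + b)) (smul : ∀ (c : K) a, p a → p (c • a))
    (word : ∀ w, p (word K w)) : p a := by
  refine MonoidAlgebra.induction_linear a zero add fun w c => ?_
  have h := smul c _ (word w)
  rwa [OPoly.word, MonoidAlgebra.smul_single', mul_one] at h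

theorem eval_P (a : OPoly K X) : eval q f (P K X a) = q (eval q f a) := by
  induction a using induction_word with
  | zero => simp
  | add a b ha hb => simp only [map_add, ha, hb]
  | smul c a h => simp only [map_smul, h]
  | word w => rw [P_word, eval_word, eval_word]; exact fold_op _ _ _ mul_comm mul_assoc w

variable {q} {lam : K}

/-- The kernel is itself an operated ideal, since evaluation is multiplicative and commutes with the
operators; it contains the relations by the Rota-Baxter identity in `A`. -/
theorem Id_le_ker_eval (hq : IsRotaBaxter lam q) :
    Id (rotaBaxterRelations X lam) ≤ LinearMap.ker (eval q f : OPoly K X →ₗ[K] A) := by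
  refine sInf_le ⟨⟨fun a b hb => ?_, fun b hb => ?_⟩, ?_⟩
  · change eval q f (a * b) = 0
    change eval q f b = 0 at hb
    rw [map_mul, hb, mul_zero]
  · change eval q f (P K X b) = 0
    change eval q f b = 0 at hb
    rw [eval_P, hb, map_zero]
  · rintro _ ⟨u, v, rfl⟩
    change eval q f _ = 0
    simp only [map_sub, map_mul, map_smul, eval_P, hq (eval q f (word K u))]
    abel

end OPoly

/-! ### The quotient by the Rota-Baxter relations -/

namespace OQuot

open OWord

variable {K : Type u} [CommRing K] {X : Type v}

section

variable (S : Set (OPoly K X))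

theorem mk_P (a : OPoly K X) : P S (mk S a) = mk S (OPoly.P K X a) := rfl

theorem P_ofWord (w : OWord X) : P S (ofWord S w) = ofWord S (op w) := by
  rw [ofWord, mk_P, OPoly.P_word, ofWord]

theorem ofWord_mul (v w : OWord X) : ofWord S (v * w) = ofWord S v * ofWord S w := by
  rw [ofWord, ← OPoly.word_mul_word, mk_mul, ofWord, ofWord]

variable {S}

theorem mk_eq_zero {a : OPoly K X} (h : a ∈ S) : mk S a = 0 :=
  (Submodule.Quotient.mk_eq_zero _).2 ((Submodule.mem_sInf).2 fun _ hI => hI.2 h)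

@[elab_as_elim]
theorem induction_ofWord {p : OQuot S → Prop} (a : OQuot S) (zero : p 0)
    (add : ∀ a b, p a → p b → p (a + b)) (smul : ∀ (c : K) a, p a → p (c • a))
    (ofWord : ∀ w, p (ofWord S w)) : p a := by
  obtain ⟨a, rfl⟩ := mk_surjective S a
  induction a using OPoly.induction_word with
  | zero => rwa [map_zero]
  | add a b ha hb => rw [map_add]; exact add _ _ ha hb
  | smul c a h => rw [map_smul]; exact smul _ _ h
  | word w => exact ofWord w

end

variable {lam : K}

theorem isRotaBaxter_P : IsRotaBaxter lam (P (OPoly.rotaBaxterRelations X lam)) := by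
  intro a b
  induction a using induction_ofWord with
  | zero => simp
  | add a a' h h' => simp only [map_add, add_mul, h, h', smul_add]; abel
  | smul c a h => simp only [map_smul, smul_mul_assoc, h, smul_add, smul_comm c lam]
  | ofWord v =>
    induction b using induction_ofWord with
    | zero => simp
    | add b b' h h' => simp only [map_add, mul_add, h, h', smul_add]; abel
    | smul c b h => simp only [map_smul, mul_smul_comm, h, smul_add, smul_comm c lam]
    | ofWord w =>
      have h := mk_eq_zero (S := OPoly.rotaBaxterRelations X lam) ⟨v, w, rfl⟩
      simp only [map_sub, map_smul, mk_mul, ← mk_P] at h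
      rw [sub_sub, sub_sub, sub_eq_zero] at h
      exact h.trans (add_assoc _ _ _).symm

/-! ### The universal property -/

section lift

variable {A : Type w} [NonUnitalCommRing A] [Module K A] [IsScalarTower K A A]
  [SMulCommClass K A A] {q : A →ₗ[K] A} (hq : IsRotaBaxter lam q) (f : X → A)

/-- The homomorphism of Rota-Baxter algebras that extends a map on the generators. -/
noncomputable def lift : OQuot (OPoly.rotaBaxterRelations X lam) →ₙₐ[K] A where
  __ := (OPoly.Id _).liftQ (OPoly.eval q f : OPoly K X →ₗ[K] A) (OPoly.Id_le_ker_eval f hq)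
  map_zero' := map_zero _
  map_mul' a b := by
    obtain ⟨a, rfl⟩ := mk_surjective _ a
    obtain ⟨b, rfl⟩ := mk_surjective _ b
    exact map_mul (OPoly.eval q f) a b

theorem lift_mk (a : OPoly K X) : lift hq f (mk _ a) = OPoly.eval q f a := rfl

theorem lift_P (a : OQuot (OPoly.rotaBaxterRelations X lam)) :
    lift hq f (P _ a) = q (lift hq f a) := by
  obtain ⟨a, rfl⟩ := mk_surjective _ a
  rw [mk_P, lift_mk, lift_mk, OPoly.eval_P]

theorem lift_ofWord_var (x : X) : lift hq f (ofWord _ (var x)) = f x := by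
  rw [ofWord, lift_mk, OPoly.eval_word]; rfl

end lift

theorem isFreeCommRotaBaxter : IsFreeCommRotaBaxter.{w} lam (P (OPoly.rotaBaxterRelations X lam))
    (fun x : X => ofWord (OPoly.rotaBaxterRelations X lam) (var x)) := by
  refine ⟨isRotaBaxter_P, fun A _ _ _ _ q hq f =>
    ⟨lift hq f, ⟨lift_P hq f, lift_ofWord_var hq f⟩, ?_⟩⟩
  rintro φ ⟨hP, hX⟩
  ext a
  induction a using induction_ofWord with
  | zero => rw [map_zero, map_zero]
  | add a b ha hb => rw [map_add, map_add, ha, hb]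
  | smul c a h => rw [map_smul, map_smul, h]
  | ofWord w =>
    induction w using OWord.induction with
    | var x => rw [hX, lift_ofWord_var]
    | op w ih => rw [← P_ofWord, hP, lift_P, ih]
    | mul v w ihv ihw => rw [ofWord_mul, map_mul, map_mul, ihv, ihw]

/-! ### Rota-Baxter words span -/

variable (X lam) in
/-- The span of the classes of the Rota-Baxter words. -/
noncomputable def phiSpan : Submodule K (OQuot (OPoly.rotaBaxterRelations X lam)) :=
  Submodule.span K (ofWord _ '' Phi X)

theorem ofWord_mem_phiSpan {w : OWord X} (hw : w ∈ Phi X) : ofWord _ w ∈ phiSpan X lam :=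
  Submodule.subset_span ⟨w, hw, rfl⟩

theorem P_mem_phiSpan {a : OQuot (OPoly.rotaBaxterRelations X lam)} (ha : a ∈ phiSpan X lam) :
    P _ a ∈ phiSpan X lam := by
  induction ha using Submodule.span_induction with
  | mem a ha =>
    obtain ⟨w, hw, rfl⟩ := ha
    rw [P_ofWord]
    exact ofWord_mem_phiSpan (op_mem_Phi hw)
  | zero => rw [map_zero]; exact zero_mem _
  | add a b _ _ ha hb => rw [map_add]; exact add_mem ha hb
  | smul c a _ h => rw [map_smul]; exact Submodule.smul_mem _ c h

theorem CS_mul_mem_phiSpan {u : OWord X} (hu : u ∈ CS X)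
    {a : OQuot (OPoly.rotaBaxterRelations X lam)} (ha : a ∈ phiSpan X lam) :
    ofWord _ u * a ∈ phiSpan X lam := by
  induction ha using Submodule.span_induction with
  | mem a ha =>
    obtain ⟨w, hw, rfl⟩ := ha
    rw [← ofWord_mul]
    exact ofWord_mem_phiSpan (CS_mul_mem_Phi hu hw)
  | zero => rw [mul_zero]; exact zero_mem _
  | add a b _ _ ha hb => rw [mul_add]; exact add_mem ha hb
  | smul c a _ h => rw [mul_smul_comm]; exact Submodule.smul_mem _ c h

/-- The hypotheses concern the arguments of `P` on the right-hand side of the Rota-Baxter identity.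
-/
theorem op_mul_op_mem_phiSpan {a b : OWord X}
    (h₁ : ofWord _ (op a) * ofWord _ b ∈ phiSpan X lam)
    (h₂ : ofWord _ a * ofWord _ (op b) ∈ phiSpan X lam)
    (h₃ : ofWord _ a * ofWord _ b ∈ phiSpan X lam) :
    ofWord _ (op a) * ofWord _ (op b) ∈ phiSpan X lam := by
  rw [← P_ofWord, ← P_ofWord, isRotaBaxter_P, P_ofWord, P_ofWord]
  exact add_mem (add_mem (P_mem_phiSpan h₁) (P_mem_phiSpan h₂))
    (Submodule.smul_mem _ _ (P_mem_phiSpan h₃))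

/-- Inner half of a double induction. For `P(a)P(b)`, the product `P(a)b` is covered by induction on
the right factor, while `aP(b)` and `ab` are covered by `h`, the outer hypothesis on the left
factor. Factors from `CS X` are pulled out. -/
theorem op_mul_mem_phiSpan {a : OWord X} (ha : a ∈ Phi X)
    (h : ∀ w ∈ Phi X, ofWord _ a * ofWord _ w ∈ phiSpan X lam) {w : OWord X} (hw : w ∈ Phi X) :
    ofWord _ (op a) * ofWord _ w ∈ phiSpan X lam := by
  induction hw using Phi_induction with
  | base u hu =>
    rw [mul_comm]
    exact CS_mul_mem_phiSpan hu (ofWord_mem_phiSpan (op_mem_Phi ha))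
  | op b hb ih => exact op_mul_op_mem_phiSpan ih (h _ (op_mem_Phi hb)) (h _ hb)
  | mul_op u hu b hb ih =>
    rw [ofWord_mul, mul_left_comm]
    exact CS_mul_mem_phiSpan hu (op_mul_op_mem_phiSpan ih (h _ (op_mem_Phi hb)) (h _ hb))

theorem ofWord_mul_mem_phiSpan {v w : OWord X} (hv : v ∈ Phi X) (hw : w ∈ Phi X) :
    ofWord _ v * ofWord _ w ∈ phiSpan X lam := by
  induction hv using Phi_induction generalizing w with
  | base u hu => exact CS_mul_mem_phiSpan hu (ofWord_mem_phiSpan hw)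
  | op a ha ih => exact op_mul_mem_phiSpan ha (fun _ => ih) hw
  | mul_op u hu a ha ih =>
    rw [ofWord_mul, mul_assoc]
    exact CS_mul_mem_phiSpan hu (op_mul_mem_phiSpan ha (fun _ => ih) hw)

theorem mul_mem_phiSpan {a b : OQuot (OPoly.rotaBaxterRelations X lam)}
    (ha : a ∈ phiSpan X lam) (hb : b ∈ phiSpan X lam) : a * b ∈ phiSpan X lam := by
  induction ha, hb using Submodule.span_induction₂ with
  | mem_mem a b ha hb =>
    obtain ⟨v, hv, rfl⟩ := ha
    obtain ⟨w, hw, rfl⟩ := hb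
    exact ofWord_mul_mem_phiSpan hv hw
  | zero_left => rw [zero_mul]; exact zero_mem _
  | zero_right => rw [mul_zero]; exact zero_mem _
  | add_left a b c _ _ _ ha hb => rw [add_mul]; exact add_mem ha hb
  | add_right a b c _ _ _ hb hc => rw [mul_add]; exact add_mem hb hc
  | smul_left c a b _ _ h => rw [smul_mul_assoc]; exact Submodule.smul_mem _ c h
  | smul_right c a b _ _ h => rw [mul_smul_comm]; exact Submodule.smul_mem _ c h

theorem phiSpan_eq_top : phiSpan X lam = ⊤ := by
  refine eq_top_iff.2 fun a ha => ?_
  clear ha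
  induction a using induction_ofWord with
  | zero => exact zero_mem _
  | add a b ha hb => exact add_mem ha hb
  | smul c a h => exact Submodule.smul_mem _ c h
  | ofWord w =>
    induction w using OWord.induction with
    | var x => exact ofWord_mem_phiSpan (CS_subset_Phi (var_mem_CS x))
    | op w ih => rw [← P_ofWord]; exact P_mem_phiSpan ih
    | mul v w ihv ihw => rw [ofWord_mul]; exact mul_mem_phiSpan ihv ihw

/-! ### Rota-Baxter words are linearly independent -/

variable (X lam) in
/-- The homomorphism to the Rota-Baxter algebra constructed from quasi-shuffles that sends
`x` to `x ⊗ 1`. -/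
noncomputable def toShuffle : OQuot (OPoly.rotaBaxterRelations X lam) →ₙₐ[K]
    MonoidAlgebra (QuasiShuffle K (Multiplicative (Multiset X)) lam)
      (Multiplicative (Multiset X)) :=
  lift QuasiShuffle.isRotaBaxter_rotaBaxter fun x => MonoidAlgebra.single (.ofAdd {x}) 1

/-- The product of the variables in a multiset, with the empty word adjoined. -/
def prodVars (m : Multiplicative (Multiset X)) : WithOne (OWord X) :=
  (m.toAdd.map fun x => (var x : WithOne (OWord X))).prod

theorem prodVars_mul (m n : Multiplicative (Multiset X)) :
    prodVars (m * n) = prodVars m * prodVars n := by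
  simp [prodVars]

/-- The word `m P(m₁ P(m₂ ⋯ P(mₖ)))` of a sequence `m, m₁, ..., mₖ` of multisets. -/
def nestedWord (m : Multiplicative (Multiset X)) :
    List (Multiplicative (Multiset X)) → WithOne (OWord X)
  | [] => prodVars m
  -- `P` of the empty word is not a word, so the value `1` is a mere default; it is not reached for
  -- the sequences that come from Rota-Baxter words.
  | n :: l => prodVars m * WithOne.recOneCoe 1 (fun w => ↑(op w)) (nestedWord n l)

theorem exists_toShuffle_eq_of_mem_CS {u : OWord X} (hu : u ∈ CS X) :
    ∃ m, toShuffle X lam (ofWord _ u) = MonoidAlgebra.single m 1 ∧ prodVars m = u := by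
  induction hu using CS_induction with
  | var x =>
    exact ⟨.ofAdd {x}, lift_ofWord_var .., Multiset.prod_singleton _⟩
  | mul v w _ _ hv hw =>
    obtain ⟨m, hm, hm'⟩ := hv
    obtain ⟨n, hn, hn'⟩ := hw
    exact ⟨m * n, by rw [ofWord_mul, map_mul, hm, hn, MonoidAlgebra.single_mul_single, one_mul],
      by rw [prodVars_mul, hm', hn', WithOne.coe_mul]⟩

theorem toShuffle_op {w : OWord X} {m : Multiplicative (Multiset X)}
    {l : List (Multiplicative (Multiset X))}
    (h : toShuffle X lam (ofWord _ w) = MonoidAlgebra.single m (.of lam l)) :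
    toShuffle X lam (ofWord _ (op w)) = MonoidAlgebra.single 1 (.of lam (m :: l)) := by
  rw [← P_ofWord, toShuffle, lift_P, ← toShuffle, h, QuasiShuffle.rotaBaxter_single,
    QuasiShuffle.cons_of]

/-- No genuine shuffle occurs: in `u P(v)` the image of `u` has the empty list, which is the unit,
and that of `P(v)` has monoid component `1`. Recovering `w` by `nestedWord` makes the assignment of
`(m, l)` to `w` injective. -/
theorem exists_toShuffle_eq {w : OWord X} (hw : w ∈ Phi X) :
    ∃ m l, toShuffle X lam (ofWord _ w) = MonoidAlgebra.single m (.of lam l) ∧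
      nestedWord m l = w := by
  induction hw using Phi_induction with
  | base u hu =>
    obtain ⟨m, hm, hm'⟩ := exists_toShuffle_eq_of_mem_CS (lam := lam) hu
    exact ⟨m, [], hm, hm'⟩
  | op v hv ih =>
    obtain ⟨m, l, h, h'⟩ := ih
    refine ⟨1, m :: l, toShuffle_op h, ?_⟩
    rw [nestedWord, h']
    exact one_mul _
  | mul_op u hu v hv ih =>
    obtain ⟨n, hn, hn'⟩ := exists_toShuffle_eq_of_mem_CS (lam := lam) hu
    obtain ⟨m, l, h, h'⟩ := ih
    refine ⟨n, m :: l, ?_, ?_⟩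
    · rw [ofWord_mul, map_mul, hn, toShuffle_op h, MonoidAlgebra.single_mul_single, mul_one,
        one_mul]
    · rw [nestedWord, h', hn']
      rfl

variable (X lam) in
-- The coordinate functionals of the model at the vectors `m w ⊗ l w`, pulled back along
-- `toShuffle`, form a dual family.
theorem linearIndependent_ofWord :
    LinearIndependent K fun w : Phi X => ofWord (OPoly.rotaBaxterRelations X lam) (w : OWord X) := by
  choose m l h hw using fun w : Phi X => exists_toShuffle_eq (lam := lam) w.2
  refine LinearIndependent.of_pairwise_dual_eq_zero_one _
    (fun w => QuasiShuffle.coeff (lam := lam) (l w) ∘ₗ Finsupp.lapply (m w) ∘ₗ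
      (MonoidAlgebra.coeffLinearEquiv K).toLinearMap ∘ₗ
        (toShuffle X lam : OQuot (OPoly.rotaBaxterRelations X lam) →ₗ[K] _)) ?_ ?_
  · intro v w hvw
    change QuasiShuffle.coeff (l v) ((toShuffle X lam (ofWord _ (w : OWord X))).coeff (m v)) = 0
    rw [h, MonoidAlgebra.coeff_single]
    by_cases hm : m v = m w
    · rw [hm, Finsupp.single_eq_same]
      -- Equal pairs `(m, l)` would give equal nested words, hence `v = w`.
      refine QuasiShuffle.coeff_of_ne fun hl => hvw (Subtype.ext (WithOne.coe_injective ?_))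
      rw [← hw, ← hw, hm, hl]
    · rw [Finsupp.single_eq_of_ne hm, map_zero]
  · intro w
    change QuasiShuffle.coeff (l w) ((toShuffle X lam (ofWord _ (w : OWord X))).coeff (m w)) = 1
    rw [h, MonoidAlgebra.coeff_single, Finsupp.single_eq_same, QuasiShuffle.coeff_of_self]

theorem exists_basis_Phi : ∃ b : Module.Basis (Phi X) K (OQuot (OPoly.rotaBaxterRelations X lam)),
    ∀ w : Phi X, b w = ofWord (OPoly.rotaBaxterRelations X lam) w := by
  refine ⟨.mk (linearIndependent_ofWord X lam) ?_, fun w => Module.Basis.mk_apply ..⟩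
  rw [← phiSpan_eq_top, phiSpan, Set.image_eq_range]

end OQuot

theorem theorem4p2 {K : Type u} [CommRing K] [Nontrivial K] {X : Type v}
    [LinearOrder X] [WellFoundedLT X] (lam : K) :
    OPoly.Irr OWord.Gt (OPoly.rotaBaxterRelations X lam) = OWord.Phi X ∧
    (∃ b : Module.Basis (OWord.Phi X) K (OQuot (OPoly.rotaBaxterRelations X lam)),
      ∀ w : OWord.Phi X, b w = OQuot.ofWord (OPoly.rotaBaxterRelations X lam) w) ∧
    IsFreeCommRotaBaxter.{w} lam (OQuot.P (OPoly.rotaBaxterRelations X lam))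
      (fun x : X => OQuot.ofWord (OPoly.rotaBaxterRelations X lam) (OWord.var x)) :=
  ⟨OPoly.irr_rotaBaxterRelations lam, OQuot.exists_basis_Phi, OQuot.isFreeCommRotaBaxter⟩
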